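/- **Setting.** There are $n$ nodes on an asynchronous network. An adversary delays messages arbitrarily (but they eventually arrive) and corrupts, adaptively, at most $t$ nodes in total; $\mathcal F$ ($|\mathcal F|\le t$) is the set of all dishonest nodes, which may behave arbitrarily, and the nodes outside $\mathcal F$ are honest. The inputs of a protocol are chosen by its environment and are not foreseen: any finite part of an execution can be continued to an execution with any further inputs of the honest nodes. A node inputs at most one value and outputs at most one value in each protocol instance (later inputs are ignored). A *Byzantine agreement* protocol satisfies, in all executions: (Termination) if all honest nodes receive inputs, every honest node eventually outputs a value; (Consistency) if an honest node outputs $v$, every honest node eventually outputs $v$; (Validity) if all honest nodes input the same value $v$, every honest node eventually outputs $v$. A *reliable broadcast* (RBC) protocol with a leader satisfies, in all executions: (Consistency) any two values output by honest nodes are equal; (Validity) if the leader is honest and inputs $v$, every honest node eventually outputs $v$; (Totality) if one honest node outputs a value, every honest node eventually outputs a value. An $(n,k)$ *erasure code* over an alphabet $\mathcal A$ consists of an encoder $\mathrm{Enc}=(\mathrm{Enc}_1,\dots,\mathrm{Enc}_n):\mathcal A^k\to\mathcal A^n$ and a decoder $\mathrm{Dec}$ which recovers $\boldsymbol w$ from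 $\{\mathrm{Enc}_j(\boldsymbol w)\}_{j\in J}$ for every $J\subseteq\{1,\dots,n\}$ with $|J|=k$. **Protocol OciorABA\*.** Fix an $(n,t+1)$ erasure code, an RBC protocol and a binary Byzantine agreement protocol (ABBA), each tolerating $t$ dishonest nodes. For every $j\in\{1,\dots,n\}$ run one instance $\mathrm{RBC}[j]$ with leader $j$ and one instance $\mathrm{ABBA}[j]$. Each honest node $i$ acts as follows; every step is executed after an arbitrary finite delay. 1. Upon receiving its input $\boldsymbol w_i\in\mathcal A^{t+1}$, it passes $\mathrm{Enc}_i(\boldsymbol w_i)$ into $\mathrm{RBC}[i]$. 2. Upon delivery of a symbol $y_j$ from $\mathrm{RBC}[j]$, and once it has received $\boldsymbol w_i$, it passes $1$ into $\mathrm{ABBA}[j]$ if $y_j=\mathrm{Enc}_j(\boldsymbol w_i)$ and $0$ otherwise (unless it has already passed an input into $\mathrm{ABBA}[j]$). 3. Upon delivery of the outputs of $n-t$ instances of ABBA, it passes $0$ into each instance of ABBA into which it has not passed an input yet. 4. Upon delivery of the outputs of all $n$ instances of ABBA, let $S$ be the set of those $j$ for which $\mathrm{ABBA}[j]$ has delivered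 $1$. If $|S|<t+1$, it outputs a default value $\bot$ and terminates. Otherwise let $K\subseteq S$ consist of the $t+1$ smallest elements of $S$; it waits for the delivery of $y_j$ from $\mathrm{RBC}[j]$ for all $j\in K$, outputs $\mathrm{Dec}(\{y_j\}_{j\in K})$ and terminates. **Theorem (Validity of OciorABA\*).** Let $n\ge 3t+1$. In every execution of OciorABA\* in which all honest nodes input the same $\boldsymbol w$, every honest node eventually outputs $\boldsymbol w$. Moreover, in such an execution there is a set $S\subseteq\{1,\dots,n\}$ with $|S|\ge t+1$ such that at every honest node $\mathrm{ABBA}[j]$ eventually delivers $1$ for all $j\in S$ and $0$ for all $j\notin S$; for every $j\in S$, $\mathrm{RBC}[j]$ eventually delivers the symbol $\mathrm{Enc}_j(\boldsymbol w)$ at every honest node; and the symbols delivered by $\mathrm{RBC}[j]$ for the $t+1$ smallest $j\in S$ decode to $\boldsymbol w$. -/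

import Mathlib

namespace Ocior

/-- An `(n, k)` erasure code over the alphabet `A`: `enc` maps a message of `k` symbols to `n`
encoded symbols, and `dec J` recovers the message from the encoded symbols at the positions in `J`,
for every set `J` of `k` positions. -/
structure ErasureCode (n k : ℕ) (A : Type*) where
  enc : (Fin k → A) → Fin n → A
  dec : (J : Finset (Fin n)) → (J → A) → Fin k → A
  dec_enc : ∀ (J : Finset (Fin n)), J.card = k →
    ∀ w : Fin k → A, dec J (fun j => enc w j) = w

/-- A value that is recorded over (discrete, global) time and never changes once it is set. -/
def WriteOnce {α : Type*} (r : ℕ → Option α) : Prop :=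
  ∀ (σ τ : ℕ) (a : α), σ ≤ τ → r σ = some a → r τ = some a

/-- What is visible of one execution of a protocol instance among `n` nodes: `inp τ i` is the input
which node `i` has passed into the instance up to time `τ` (`none` if there is no such input yet),
and `out τ i` is the output which the instance has delivered at node `i` up to time `τ`. -/
structure History (n : ℕ) (In Out : Type*) where
  inp : ℕ → Fin n → Option In
  out : ℕ → Fin n → Option Out
  inp_once : ∀ i, WriteOnce fun τ => inp τ i
  out_once : ∀ i, WriteOnce fun τ => out τ i

/-- Node `i` (eventually) inputs `v`. -/
def History.Inputs {n : ℕ} {In Out : Type*} (h : History n In Out) (i : Fin n) (v : In) : Prop :=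
  ∃ τ, h.inp τ i = some v

/-- Node `i` eventually outputs `v`. -/
def History.Outputs {n : ℕ} {In Out : Type*} (h : History n In Out) (i : Fin n) (v : Out) : Prop :=
  ∃ τ, h.out τ i = some v

/-- A protocol for `n` nodes on an asynchronous network, given by its executions: `execs F` is the
set of (the visible parts of) all executions, for all message delays, all coins, and all behaviours
of the adversary, in which only nodes in `F` are corrupted at any time. The nodes outside `F` are
the honest ones; entries of a history at nodes in `F` carry no meaning.

`causal`: the inputs of the honest nodes are chosen by the environment and are not foreseen by the
protocol. What has happened up to a time `τ` can be continued to an execution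
with any further inputs `g` of the honest nodes. -/
structure Protocol (n : ℕ) (In Out : Type*) where
  execs : Finset (Fin n) → Set (History n In Out)
  causal : ∀ (F : Finset (Fin n)), ∀ h ∈ execs F, ∀ (τ : ℕ) (g : ℕ → Fin n → Option In),
    (∀ i, WriteOnce fun σ => g σ i) →
    (∀ σ ≤ τ, ∀ i ∉ F, g σ i = h.inp σ i) →
    ∃ h' ∈ execs F, (∀ σ, ∀ i ∉ F, h'.inp σ i = g σ i) ∧
      (∀ σ ≤ τ, ∀ i ∉ F, h'.out σ i = h.out σ i)

/-- `P` is a Byzantine agreement protocol, tolerating up to `t` dishonest nodes. -/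
structure IsByzantineAgreement {n : ℕ} {V : Type*} (t : ℕ) (P : Protocol n V V) : Prop where
  termination : ∀ F : Finset (Fin n), F.card ≤ t → ∀ h ∈ P.execs F,
    (∀ i ∉ F, ∃ v, h.Inputs i v) → ∀ i ∉ F, ∃ v, h.Outputs i v
  consistency : ∀ F : Finset (Fin n), F.card ≤ t → ∀ h ∈ P.execs F,
    ∀ i ∉ F, ∀ v, h.Outputs i v → ∀ k ∉ F, h.Outputs k v
  validity : ∀ F : Finset (Fin n), F.card ≤ t → ∀ h ∈ P.execs F,
    ∀ v, (∀ i ∉ F, h.Inputs i v) → ∀ i ∉ F, h.Outputs i v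

/-- `P` is a reliable broadcast protocol with the given leader, tolerating up to `t` dishonest
nodes. -/
structure IsReliableBroadcast {n : ℕ} {V : Type*} (t : ℕ) (leader : Fin n)
    (P : Protocol n V V) : Prop where
  consistency : ∀ F : Finset (Fin n), F.card ≤ t → ∀ h ∈ P.execs F,
    ∀ i ∉ F, ∀ k ∉ F, ∀ v v', h.Outputs i v → h.Outputs k v' → v = v'
  validity : ∀ F : Finset (Fin n), F.card ≤ t → ∀ h ∈ P.execs F,
    leader ∉ F → ∀ v, h.Inputs leader v → ∀ i ∉ F, h.Outputs i v
  totality : ∀ F : Finset (Fin n), F.card ≤ t → ∀ h ∈ P.execs F,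
    ∀ i ∉ F, ∀ v, h.Outputs i v → ∀ k ∉ F, ∃ v', h.Outputs k v'

/-- The `k` smallest elements of `S` (all of `S` if it has fewer elements). -/
def smallest {n : ℕ} (k : ℕ) (S : Finset (Fin n)) : Finset (Fin n) :=
  S.filter fun j => (S.filter fun j' => j' < j).card < k

/-- How an asynchronous process sets a write-once value `reg`, when `may τ a` says that its code
allows the value `a` in its state at time `τ`, and `stopped τ` says that the process has terminated
by time `τ`. The value is not set initially; it is set only to a value which the code allows, before
termination; and if the code allows some value then, after an arbitrary finite delay, the
value is set or the process has terminated. -/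
structure Follows {α : Type*} (stopped : ℕ → Prop) (may : ℕ → α → Prop)
    (reg : ℕ → Option α) : Prop where
  init : reg 0 = none
  safe : ∀ τ a, reg τ = none → reg (τ + 1) = some a → may τ a ∧ ¬ stopped τ
  live : ∀ τ a, may τ a → ∃ τ', reg τ' ≠ none ∨ stopped τ'

/-- What a node of OciorABA* has seen at some time: its input message, the symbols delivered from
`RBC[j]`, and the bits delivered from `ABBA[j]`, for all `j`. -/
structure View (n t : ℕ) (A : Type*) where
  input : Option (Fin (t + 1) → A)
  rbcOut : Fin n → Option A
  abbaOut : Fin n → Option Bool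

section Code

variable {n t : ℕ} {A : Type*} (EC : ErasureCode n (t + 1) A)

/-- What node `i` has seen up to time `τ`. -/
def viewAt (main : History n (Fin (t + 1) → A) (Option (Fin (t + 1) → A)))
    (rbc : Fin n → History n A A) (abba : Fin n → History n Bool Bool)
    (i : Fin n) (τ : ℕ) : View n t A where
  input := main.inp τ i
  rbcOut j := (rbc j).out τ i
  abbaOut j := (abba j).out τ i

/-- Upon receiving the input `w`, node `i` passes the `i`-th encoded symbol of `w` into `RBC[i]`. -/
def MayPassToRBC (i : Fin n) (v : View n t A) (y : A) : Prop :=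
  ∃ w, v.input = some w ∧ y = EC.enc w i

/-- The two rules by which a node passes the bit `b` into `ABBA[j]`, if it has not passed any input
into `ABBA[j]` yet.
1. Upon delivery of a symbol from `RBC[j]`, and after the node has encoded its own input: the bit is
`1` if the symbol equals the `j`-th encoded symbol of its own input, and `0` otherwise.
2. Upon delivery of the outputs of `n - t` instances of ABBA: the bit is `0`. -/
def MayPassToABBA (j : Fin n) (v : View n t A) (b : Bool) : Prop :=
  (∃ w y, v.input = some w ∧ v.rbcOut j = some y ∧ (b = true ↔ y = EC.enc w j)) ∨
  (n - t ≤ (Finset.univ.filter fun j' => v.abbaOut j' ≠ none).card ∧ b = false)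

/-- The set of the instances of ABBA which have delivered `1`. -/
def View.ones (v : View n t A) : Finset (Fin n) :=
  Finset.univ.filter fun j => v.abbaOut j = some true

/-- The rule by which a node outputs (and terminates): all `n` instances of ABBA have delivered their
outputs, and then it outputs the default value, here `none`, if fewer than `t + 1` of them have
delivered `1`; otherwise it waits for the symbols from `RBC[j]` for the `t + 1` smallest such `j` and
outputs the message decoded from them. -/
def MayOutput (v : View n t A) (o : Option (Fin (t + 1) → A)) : Prop :=
  (∀ j, v.abbaOut j ≠ none) ∧
  ((v.ones.card < t + 1 ∧ o = none) ∨
   (t + 1 ≤ v.ones.card ∧ ∃ y : smallest (t + 1) v.ones → A,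
      (∀ j : smallest (t + 1) v.ones, v.rbcOut j = some (y j)) ∧ o = some (EC.dec (smallest (t + 1) v.ones) y)))

/-- An execution of OciorABA* in which the nodes outside `F` are honest: it invokes
for every `j` one instance of the reliable broadcast `RBC j` (with node `j` as the leader) and one
instance of the binary agreement `ABBA`. `main` records the inputs and outputs of OciorABA* itself;
the inputs of honest nodes to the `2n` instances and their outputs are governed by the code.
The nodes in `F` are not constrained. -/
structure OciorABAStarExecution (RBC : Fin n → Protocol n A A) (ABBA : Protocol n Bool Bool)
    (F : Finset (Fin n)) where
  main : History n (Fin (t + 1) → A) (Option (Fin (t + 1) → A))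
  rbc : Fin n → History n A A
  abba : Fin n → History n Bool Bool
  rbc_mem : ∀ j, rbc j ∈ (RBC j).execs F
  abba_mem : ∀ j, abba j ∈ ABBA.execs F
  rbc_input : ∀ i ∉ F, Follows (fun τ => main.out τ i ≠ none)
    (fun τ y => MayPassToRBC EC i (viewAt main rbc abba i τ) y) (fun τ => (rbc i).inp τ i)
  rbc_only_leader : ∀ i ∉ F, ∀ j, j ≠ i → ∀ τ, (rbc j).inp τ i = none
  abba_input : ∀ i ∉ F, ∀ j, Follows (fun τ => main.out τ i ≠ none)
    (fun τ b => MayPassToABBA EC j (viewAt main rbc abba i τ) b) (fun τ => (abba j).inp τ i)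
  output : ∀ i ∉ F, Follows (fun τ => main.out τ i ≠ none)
    (fun τ o => MayOutput EC (viewAt main rbc abba i τ) o) (fun τ => main.out τ i)

end Code

end Ocior

namespace Ocior

variable {n t : ℕ}

/-! The axioms speak of eventual outputs; causality turns them into safety. If ABBA output a bit
that no honest node had input, the run could be continued with all honest nodes inputting the other
bit, against validity (`IsByzantineAgreement.exists_input`). Likewise an honest leader's RBC
delivers only the leader's symbol (`IsReliableBroadcast.output_eq`).

So a `1` from `ABBA[j]` means that some honest node received the symbol of `w` from `RBC[j]`, and by
totality and consistency all do. Up to the first time at which an honest node has seen `n - t` ABBA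
outputs, no honest node has input `0` for an honest `j`; discarding at most `t` dishonest indices
leaves at least `n - 2t ≥ t + 1` ones (`exists_card_abba_outputs_true`). For liveness
(`abba_outputs`), honest broadcasts yield `n - t` ABBA outputs, which release the zeros completing
the remaining instances. Hence all honest nodes decode the same correct symbols. -/

theorem WriteOnce.eq_of_eq_some {α : Type*} {r : ℕ → Option α} (hr : WriteOnce r) {σ τ : ℕ}
    {a b : α} (ha : r σ = some a) (hb : r τ = some b) : a = b := by
  have h₁ := hr σ (max σ τ) a (le_max_left _ _) ha
  have h₂ := hr τ (max σ τ) b (le_max_right _ _) hb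
  exact Option.some.inj (h₁.symm.trans h₂)

/-- The record which agrees with `r` up to time `τ` and is set to `a` afterwards, unless it has
already been set. -/
def fillAfter {α : Type*} (r : ℕ → Option α) (τ : ℕ) (a : α) (σ : ℕ) : Option α :=
  if σ ≤ τ then r σ else some ((r τ).getD a)

theorem WriteOnce.fillAfter {α : Type*} {r : ℕ → Option α} (hr : WriteOnce r) (τ : ℕ) (a : α) :
    WriteOnce (fillAfter r τ a) := by
  intro σ₁ σ₂ b hle hb
  unfold Ocior.fillAfter at hb ⊢
  by_cases h₁ : σ₁ ≤ τ
  · rw [if_pos h₁] at hb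
    by_cases h₂ : σ₂ ≤ τ
    · rw [if_pos h₂]
      exact hr _ _ _ hle hb
    · rw [if_neg h₂, hr _ _ _ h₁ hb, Option.getD_some]
  · rw [if_neg h₁] at hb
    rwa [if_neg (fun h => h₁ (hle.trans h))]

/-! ### Safety from causality -/

/-- A finite part of an execution in which the honest nodes have passed in no other values than
`f i` continues to an execution in which each honest node `i` inputs `f i`. -/
theorem Protocol.exists_continuation {In Out : Type*} (P : Protocol n In Out)
    {F : Finset (Fin n)} {h : History n In Out} (hh : h ∈ P.execs F) (τ : ℕ) (f : Fin n → In)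
    (hf : ∀ i ∉ F, ∀ a, h.inp τ i = some a → a = f i) :
    ∃ h' ∈ P.execs F, (∀ i ∉ F, h'.Inputs i (f i)) ∧ ∀ i ∉ F, h'.out τ i = h.out τ i := by
  obtain ⟨h', hmem, hinp, hout⟩ := P.causal F h hh τ
    (fun σ i => fillAfter (fun σ => h.inp σ i) τ (f i) σ)
    (fun i => (h.inp_once i).fillAfter τ (f i))
    (fun σ hσ i _ => if_pos hσ)
  refine ⟨h', hmem, fun i hi => ⟨τ + 1, ?_⟩, hout τ le_rfl⟩
  rw [hinp _ i hi, fillAfter, if_neg (by omega)]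
  cases hv : h.inp τ i with
  | none => rfl
  | some a => rw [Option.getD_some, hf i hi a hv]

/-- A bit which a binary agreement has output has been input by an honest node before. -/
theorem IsByzantineAgreement.exists_input {P : Protocol n Bool Bool}
    (hP : IsByzantineAgreement t P) {F : Finset (Fin n)} (hF : F.card ≤ t)
    {h : History n Bool Bool} (hh : h ∈ P.execs F) {i : Fin n} (hi : i ∉ F) {τ : ℕ} {b : Bool}
    (hb : h.out τ i = some b) : ∃ k ∉ F, h.inp τ k = some b := by
  by_contra! hno
  -- With two bits, every honest input so far is `!b`, so unanimity on `!b` is still possible.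
  obtain ⟨h', hmem, hinp, hout⟩ := P.exists_continuation hh τ (fun _ => !b) (by
    intro k hk a ha
    exact Bool.eq_not.2 fun hab => hno k hk (hab ▸ ha))
  obtain ⟨τ', hτ'⟩ := hP.validity F hF h' hmem (!b) hinp i hi
  exact (Bool.eq_not_self b).1 ((h'.out_once i).eq_of_eq_some ((hout i hi).trans hb) hτ')

/-- If an honest leader inputs no other value than `y`, then no other value is delivered. -/
theorem IsReliableBroadcast.output_eq {V : Type*} {j : Fin n} {P : Protocol n V V}
    (hP : IsReliableBroadcast t j P) {F : Finset (Fin n)} (hF : F.card ≤ t)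
    {h : History n V V} (hh : h ∈ P.execs F) (hj : j ∉ F) {y : V}
    (hinp : ∀ a, h.Inputs j a → a = y) {i : Fin n} (hi : i ∉ F) {a : V} (ha : h.Outputs i a) :
    a = y := by
  obtain ⟨τ, hτ⟩ := ha
  obtain ⟨h', hmem, hinp', hout⟩ := P.exists_continuation hh τ
    -- Only the leader's input matters; any other node keeps what it has input, with `y` as an
    -- arbitrary default.
    (fun k => if k = j then y else (h.inp τ k).getD y) (by
      intro k _ b hb
      split_ifs with hkj
      · exact hinp b ⟨τ, hkj ▸ hb⟩
      · rw [hb, Option.getD_some])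
  have hy := hinp' j hj
  rw [if_pos rfl] at hy
  obtain ⟨τ', hτ'⟩ := hP.validity F hF h' hmem hj y hy i hi
  exact (h'.out_once i).eq_of_eq_some ((hout i hi).trans hτ) hτ'

theorem IsReliableBroadcast.outputs_all {V : Type*} {j : Fin n} {P : Protocol n V V}
    (hP : IsReliableBroadcast t j P) {F : Finset (Fin n)} (hF : F.card ≤ t)
    {h : History n V V} (hh : h ∈ P.execs F) {i : Fin n} (hi : i ∉ F) {v : V}
    (hv : h.Outputs i v) : ∀ k ∉ F, h.Outputs k v := by
  intro k hk
  obtain ⟨v', hv'⟩ := hP.totality F hF h hh i hi v hv k hk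
  rwa [hP.consistency F hF h hh i hi k hk v v' hv hv']

/-- Traces a set value back to the step that set it. Strictness of `σ < τ` is what lets minimality
of a time exclude causes of events at that time. -/
theorem Follows.exists_lt {α : Type*} {stopped : ℕ → Prop} {may : ℕ → α → Prop}
    {reg : ℕ → Option α} (hr : Follows stopped may reg) (hw : WriteOnce reg) {τ : ℕ} {a : α}
    (ha : reg τ = some a) : ∃ σ < τ, may σ a := by
  induction τ with
  | zero => simp [hr.init] at ha
  | succ τ ih =>
    cases hv : reg τ with
    | none => exact ⟨τ, τ.lt_succ_self, (hr.safe τ a hv ha).1⟩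
    | some b =>
      obtain rfl := Option.some.inj ((hw τ (τ + 1) b τ.le_succ hv).symm.trans ha)
      obtain ⟨σ, hσ, hm⟩ := ih hv
      exact ⟨σ, hσ.trans τ.lt_succ_self, hm⟩

/-- The rank of an element, the number of smaller elements of `S`, maps `S` bijectively onto `0, …,
|S| - 1`; the selected elements are those of rank below `k`. -/
theorem card_smallest {k : ℕ} {S : Finset (Fin n)} (h : k ≤ S.card) :
    (smallest k S).card = k := by
  have hlt : ∀ a ∈ S, ∀ b, a < b → (S.filter (· < a)).card < (S.filter (· < b)).card := by
    intro a ha b hab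
    refine Finset.card_lt_card (Finset.ssubset_iff_of_subset ?_ |>.2 ⟨a, by simp [ha, hab], by simp⟩)
    exact Finset.monotone_filter_right _ fun x _ hx => lt_trans hx hab
  have hinj : Set.InjOn (fun j => (S.filter (· < j)).card) (S : Set (Fin n)) := by
    intro a ha b hb hab
    dsimp only at hab
    rcases lt_trichotomy a b with h | h | h
    · exact absurd hab (hlt a ha b h).ne
    · exact h
    · exact absurd hab (hlt b hb a h).ne'
  have hrank : S.image (fun j => (S.filter (· < j)).card) = Finset.range S.card := by
    refine Finset.eq_of_subset_of_card_le ?_ ?_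
    · intro m hm
      obtain ⟨j, hj, rfl⟩ := Finset.mem_image.1 hm
      refine Finset.mem_range.2 (Finset.card_lt_card ?_)
      exact Finset.filter_ssubset.2 ⟨j, hj, lt_irrefl j⟩
    · rw [Finset.card_range, Finset.card_image_of_injOn hinj]
  have himage : (smallest k S).image (fun j => (S.filter (· < j)).card) = Finset.range k := by
    ext m
    constructor
    · intro hm
      obtain ⟨j, hj, rfl⟩ := Finset.mem_image.1 hm
      exact Finset.mem_range.2 (Finset.mem_filter.1 hj).2
    · intro hm
      have hmk := Finset.mem_range.1 hm
      have : m ∈ S.image (fun j => (S.filter (· < j)).card) :=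
        hrank ▸ Finset.mem_range.2 (hmk.trans_le h)
      obtain ⟨j, hj, rfl⟩ := Finset.mem_image.1 this
      exact Finset.mem_image.2 ⟨j, Finset.mem_filter.2 ⟨hj, hmk⟩, rfl⟩
  have hsub : smallest k S ⊆ S := Finset.filter_subset _ _
  rw [← Finset.card_image_of_injOn (hinj.mono (Finset.coe_subset.2 hsub)), himage,
    Finset.card_range]

/-- Finitely many write-once values which are all set eventually are all set at some time. -/
theorem exists_time_forall {ι α : Type*} (s : Finset ι) (r : ι → ℕ → Option α)
    (hr : ∀ i, WriteOnce (r i)) (a : ι → α) (h : ∀ i ∈ s, ∃ τ, r i τ = some (a i)) :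
    ∃ T, ∀ τ ≥ T, ∀ i ∈ s, r i τ = some (a i) := by
  choose! T hT using h
  exact ⟨s.sup T, fun τ hτ i hi =>
    hr i _ _ _ ((Finset.le_sup (f := T) hi).trans hτ) (hT i hi)⟩

namespace OciorABAStarExecution

variable {A : Type*} {EC : ErasureCode n (t + 1) A} {RBC : Fin n → Protocol n A A}
  {ABBA : Protocol n Bool Bool} {F : Finset (Fin n)}
  {e : OciorABAStarExecution EC RBC ABBA F}

/-- The set of the instances of ABBA which have delivered an output at node `i` by time `τ`. -/
def decided (e : OciorABAStarExecution EC RBC ABBA F) (i : Fin n) (τ : ℕ) : Finset (Fin n) :=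
  Finset.univ.filter fun j => (e.abba j).out τ i ≠ none

theorem mem_decided {i j : Fin n} {τ : ℕ} :
    j ∈ e.decided i τ ↔ ∃ b, (e.abba j).out τ i = some b := by
  simp [decided, Option.ne_none_iff_exists']

/-- Makes early termination harmless: a node that stops passing inputs has already seen every ABBA
output. -/
theorem decided_eq_univ_of_output {i : Fin n} (hi : i ∉ F) {τ : ℕ}
    (h : e.main.out τ i ≠ none) : ∃ σ, e.decided i σ = Finset.univ := by
  obtain ⟨o, ho⟩ := Option.ne_none_iff_exists'.1 h
  obtain ⟨σ, -, hσ⟩ := (e.output i hi).exists_lt (e.main.out_once i) ho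
  exact ⟨σ, Finset.filter_true_of_mem fun j _ => hσ.1 j⟩

theorem rbc_input_eq {w : Fin (t + 1) → A} (hw : ∀ i ∉ F, e.main.Inputs i w) {j : Fin n}
    (hj : j ∉ F) {a : A} (ha : (e.rbc j).Inputs j a) : a = EC.enc w j := by
  obtain ⟨τ, hτ⟩ := ha
  obtain ⟨σ, -, w', hw', rfl⟩ := (e.rbc_input j hj).exists_lt ((e.rbc j).inp_once j) hτ
  obtain ⟨τ', hτ'⟩ := hw j hj
  rw [(e.main.inp_once j).eq_of_eq_some hw' hτ']

theorem rbc_output_eq (hRBC : ∀ j, IsReliableBroadcast t j (RBC j)) (hF : F.card ≤ t)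
    {w : Fin (t + 1) → A} (hw : ∀ i ∉ F, e.main.Inputs i w) {j : Fin n} (hj : j ∉ F)
    {i : Fin n} (hi : i ∉ F) {a : A} (ha : (e.rbc j).Outputs i a) : a = EC.enc w j :=
  (hRBC j).output_eq hF (e.rbc_mem j) hj (fun _ => rbc_input_eq hw hj) hi ha

/-- If `ABBA[j]` outputs `1`, then `RBC[j]` delivers the `j`-th encoded symbol of the common input. -/
theorem rbc_outputs_of_abba_outputs_true (hRBC : ∀ j, IsReliableBroadcast t j (RBC j))
    (hABBA : IsByzantineAgreement t ABBA) (hF : F.card ≤ t) {w : Fin (t + 1) → A}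
    (hw : ∀ i ∉ F, e.main.Inputs i w) {i j : Fin n} (hi : i ∉ F)
    (h : (e.abba j).Outputs i true) : ∀ k ∉ F, (e.rbc j).Outputs k (EC.enc w j) := by
  obtain ⟨τ, hτ⟩ := h
  obtain ⟨l, hl, hinp⟩ := hABBA.exists_input hF (e.abba_mem j) hi hτ
  obtain ⟨σ, -, hσ⟩ := (e.abba_input l hl j).exists_lt ((e.abba j).inp_once l) hinp
  rcases hσ with ⟨w', y, hw', hy, hb⟩ | ⟨-, hb⟩
  · obtain ⟨τ', hτ'⟩ := hw l hl
    rw [(e.main.inp_once l).eq_of_eq_some hw' hτ'] at hb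
    rw [← hb.1 rfl]
    exact (hRBC j).outputs_all hF (e.rbc_mem j) hl ⟨σ, hy⟩
  · exact absurd hb (by simp)

/-- As long as no honest node has seen `n - t` outputs of ABBA, the instances of ABBA which belong
to honest nodes output nothing but `1`. -/
theorem abba_out_eq_true (hRBC : ∀ j, IsReliableBroadcast t j (RBC j))
    (hABBA : IsByzantineAgreement t ABBA) (hF : F.card ≤ t) {w : Fin (t + 1) → A}
    (hw : ∀ i ∉ F, e.main.Inputs i w) {T : ℕ}
    (hT : ∀ σ < T, ∀ k ∉ F, (e.decided k σ).card < n - t) {i j : Fin n} (hi : i ∉ F) (hj : j ∉ F)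
    {b : Bool} (h : (e.abba j).out T i = some b) : b = true := by
  obtain ⟨l, hl, hinp⟩ := hABBA.exists_input hF (e.abba_mem j) hi h
  obtain ⟨σ, hσT, hσ⟩ := (e.abba_input l hl j).exists_lt ((e.abba j).inp_once l) hinp
  rcases hσ with ⟨w', y, hw', hy, hb⟩ | ⟨hcard, -⟩
  · obtain ⟨τ', hτ'⟩ := hw l hl
    rw [(e.main.inp_once l).eq_of_eq_some hw' hτ'] at hb
    exact hb.2 (rbc_output_eq hRBC hF hw hj hl ⟨σ, hy⟩)
  · exact absurd hcard (not_le.2 (hT σ hσT l hl))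

/-! ### Liveness of the ABBA instances -/

/-- If nobody has terminated, then every instance of ABBA whose rules let each honest node pass in
some bit outputs. -/
theorem abba_outputs_of_may (hABBA : IsByzantineAgreement t ABBA) (hF : F.card ≤ t)
    (hrun : ∀ τ, ∀ i ∉ F, e.main.out τ i = none) {j : Fin n}
    (hmay : ∀ i ∉ F, ∃ τ b, MayPassToABBA EC j (viewAt e.main e.rbc e.abba i τ) b) :
    ∀ i ∉ F, ∃ b, (e.abba j).Outputs i b := by
  refine hABBA.termination F hF _ (e.abba_mem j) fun i hi => ?_
  obtain ⟨τ, b, hb⟩ := hmay i hi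
  obtain ⟨τ', h | h⟩ := (e.abba_input i hi j).live τ b hb
  · obtain ⟨v, hv⟩ := Option.ne_none_iff_exists'.1 h
    exact ⟨v, τ', hv⟩
  · exact absurd (hrun τ' i hi) h

theorem exists_subset_decided {i : Fin n} (s : Finset (Fin n))
    (h : ∀ j ∈ s, ∃ b, (e.abba j).Outputs i b) : ∃ τ, s ⊆ e.decided i τ := by
  choose! b hb using h
  obtain ⟨T, hT⟩ := exists_time_forall s (fun j τ => (e.abba j).out τ i)
    (fun j => (e.abba j).out_once i) b hb
  exact ⟨T, fun j hj => mem_decided.2 ⟨_, hT T le_rfl j hj⟩⟩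

theorem abba_outputs_of_output (hABBA : IsByzantineAgreement t ABBA) (hF : F.card ≤ t)
    {i : Fin n} (hi : i ∉ F) {τ : ℕ} (h : e.main.out τ i ≠ none) (j : Fin n) :
    ∀ k ∉ F, ∃ b, (e.abba j).Outputs k b := by
  intro k hk
  obtain ⟨σ, hσ⟩ := decided_eq_univ_of_output hi h
  obtain ⟨b, hb⟩ := mem_decided.1 (hσ ▸ Finset.mem_univ j)
  exact ⟨b, hABBA.consistency F hF _ (e.abba_mem j) i hi b ⟨σ, hb⟩ k hk⟩

/-- Every honest node can compare its own symbol with the one broadcast by an honest node. -/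
theorem abba_outputs_of_honest (hRBC : ∀ j, IsReliableBroadcast t j (RBC j))
    (hABBA : IsByzantineAgreement t ABBA) (hF : F.card ≤ t) {w : Fin (t + 1) → A}
    (hw : ∀ i ∉ F, e.main.Inputs i w) (hrun : ∀ τ, ∀ i ∉ F, e.main.out τ i = none)
    {j : Fin n} (hj : j ∉ F) : ∀ i ∉ F, ∃ b, (e.abba j).Outputs i b := by
  have hinp : (e.rbc j).Inputs j (EC.enc w j) := by
    obtain ⟨τ, hτ⟩ := hw j hj
    obtain ⟨τ', h | h⟩ := (e.rbc_input j hj).live τ (EC.enc w j) ⟨w, hτ, rfl⟩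
    · obtain ⟨v, hv⟩ := Option.ne_none_iff_exists'.1 h
      exact rbc_input_eq hw hj ⟨τ', hv⟩ ▸ ⟨τ', hv⟩
    · exact absurd (hrun τ' j hj) h
  refine abba_outputs_of_may hABBA hF hrun fun i hi => ?_
  obtain ⟨τ₁, h₁⟩ := hw i hi
  obtain ⟨τ₂, h₂⟩ := (hRBC j).validity F hF _ (e.rbc_mem j) hj _ hinp i hi
  exact ⟨max τ₁ τ₂, true, Or.inl ⟨w, EC.enc w j,
    e.main.inp_once i _ _ _ (le_max_left _ _) h₁,
    (e.rbc j).out_once i _ _ _ (le_max_right _ _) h₂, by simp⟩⟩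

theorem exists_decided_card (hRBC : ∀ j, IsReliableBroadcast t j (RBC j))
    (hABBA : IsByzantineAgreement t ABBA) (hF : F.card ≤ t) {w : Fin (t + 1) → A}
    (hw : ∀ i ∉ F, e.main.Inputs i w) {i : Fin n} (hi : i ∉ F) :
    ∃ τ, ∃ k ∉ F, n - t ≤ (e.decided k τ).card := by
  by_cases hrun : ∀ τ, ∀ k ∉ F, e.main.out τ k = none
  · obtain ⟨τ, hτ⟩ := exists_subset_decided (e := e) (i := i) Fᶜ fun j hj =>
      abba_outputs_of_honest hRBC hABBA hF hw hrun (Finset.mem_compl.1 hj) i hi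
    refine ⟨τ, i, hi, le_trans ?_ (Finset.card_le_card hτ)⟩
    rw [Finset.card_compl, Fintype.card_fin]
    omega
  · push Not at hrun
    obtain ⟨τ, k, hk, h⟩ := hrun
    obtain ⟨σ, hσ⟩ := decided_eq_univ_of_output hk h
    exact ⟨σ, k, hk, by simp [hσ]⟩

theorem abba_outputs (hRBC : ∀ j, IsReliableBroadcast t j (RBC j))
    (hABBA : IsByzantineAgreement t ABBA) (hF : F.card ≤ t) {w : Fin (t + 1) → A}
    (hw : ∀ i ∉ F, e.main.Inputs i w) (j : Fin n) :
    ∀ i ∉ F, ∃ b, (e.abba j).Outputs i b := by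
  intro i hi
  by_cases hrun : ∀ τ, ∀ k ∉ F, e.main.out τ k = none
  · refine abba_outputs_of_may hABBA hF hrun (fun k hk => ?_) i hi
    obtain ⟨τ, l, hl, hcard⟩ := exists_decided_card hRBC hABBA hF hw hi
    obtain ⟨τ', hτ'⟩ := exists_subset_decided (e := e) (i := k) (e.decided l τ) fun j' hj' => by
      obtain ⟨b, hb⟩ := mem_decided.1 hj'
      exact ⟨b, hABBA.consistency F hF _ (e.abba_mem j') l hl b ⟨τ, hb⟩ k hk⟩
    -- Consistency has carried the `n - t` outputs seen at `l` over to `k`, so the second rule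
    -- applies at `k`.
    exact ⟨τ', false, Or.inr ⟨hcard.trans (Finset.card_le_card hτ'), rfl⟩⟩
  · push Not at hrun
    obtain ⟨τ, k, hk, h⟩ := hrun
    exact abba_outputs_of_output hABBA hF hk h j i hi

/-! ### Counting ones and decoding -/

/-- At least `t + 1` instances of ABBA output `1`. -/
theorem exists_card_abba_outputs_true (hn : 3 * t + 1 ≤ n)
    (hRBC : ∀ j, IsReliableBroadcast t j (RBC j))
    (hABBA : IsByzantineAgreement t ABBA) (hF : F.card ≤ t) {w : Fin (t + 1) → A}
    (hw : ∀ i ∉ F, e.main.Inputs i w) {i : Fin n} (hi : i ∉ F) :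
    ∃ s : Finset (Fin n), t + 1 ≤ s.card ∧ ∀ j ∈ s, (e.abba j).Outputs i true := by
  have hex := exists_decided_card hRBC hABBA hF hw hi
  obtain ⟨k, hk, hcard⟩ := Nat.find_spec hex
  have hmin : ∀ σ < Nat.find hex, ∀ l ∉ F, (e.decided l σ).card < n - t := by
    intro σ hσ l hl
    by_contra! hge
    exact Nat.find_min hex hσ ⟨l, hl, hge⟩
  refine ⟨e.decided k (Nat.find hex) \ F, ?_, fun j hj => ?_⟩
  · have := Finset.le_card_sdiff F (e.decided k (Nat.find hex))
    omega
  · obtain ⟨hjd, hjF⟩ := Finset.mem_sdiff.1 hj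
    obtain ⟨b, hb⟩ := mem_decided.1 hjd
    obtain rfl := abba_out_eq_true hRBC hABBA hF hw hmin hk hjF hb
    exact hABBA.consistency F hF _ (e.abba_mem j) k hk true ⟨_, hb⟩ i hi

/-- If all instances of ABBA and RBC deliver consistently, then the decoded message is output. -/
theorem outputs_of_delivered {i : Fin n} (hi : i ∉ F) {w : Fin (t + 1) → A}
    {S : Finset (Fin n)} (hcard : t + 1 ≤ S.card)
    (htrue : ∀ j ∈ S, (e.abba j).Outputs i true) (hfalse : ∀ j ∉ S, (e.abba j).Outputs i false)
    (hrbc : ∀ j ∈ S, (e.rbc j).Outputs i (EC.enc w j)) : e.main.Outputs i (some w) := by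
  -- The time of the output is not known in advance, so the set of ones is identified at every time
  -- when all bits are present.
  have hones : ∀ τ, (∀ j, (e.abba j).out τ i ≠ none) →
      (viewAt e.main e.rbc e.abba i τ).ones = S := by
    intro τ hτ
    ext j
    rw [View.ones, Finset.mem_filter, and_iff_right (Finset.mem_univ j)]
    change (e.abba j).out τ i = some true ↔ j ∈ S
    constructor
    · intro h
      by_contra hj
      obtain ⟨τ', hτ'⟩ := hfalse j hj
      exact absurd (((e.abba j).out_once i).eq_of_eq_some h hτ') (by simp)
    · intro hj
      obtain ⟨b, hb⟩ := Option.ne_none_iff_exists'.1 (hτ j)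
      obtain ⟨τ', hτ'⟩ := htrue j hj
      rw [hb, ((e.abba j).out_once i).eq_of_eq_some hb hτ']
  have hmay : ∃ τ, MayOutput EC (viewAt e.main e.rbc e.abba i τ) (some w) := by
    obtain ⟨T₁, h₁⟩ := exists_time_forall Finset.univ (fun j τ => (e.abba j).out τ i)
      (fun j => (e.abba j).out_once i) (fun j => decide (j ∈ S)) (by
        intro j _
        by_cases hj : j ∈ S
        · simpa [hj] using! htrue j hj
        · simpa [hj] using! hfalse j hj)
    obtain ⟨T₂, h₂⟩ := exists_time_forall S (fun j τ => (e.rbc j).out τ i)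
      (fun j => (e.rbc j).out_once i) (EC.enc w) hrbc
    have hset : ∀ j, (e.abba j).out (max T₁ T₂) i ≠ none := fun j => by
      rw [h₁ _ (le_max_left _ _) j (Finset.mem_univ j)]
      simp
    refine ⟨max T₁ T₂, hset, Or.inr ?_⟩
    rw [hones _ hset]
    exact ⟨hcard, fun j => EC.enc w j,
      fun j => h₂ _ (le_max_right _ _) j (Finset.filter_subset _ _ j.2),
      by rw [EC.dec_enc _ (card_smallest hcard)]⟩
  obtain ⟨τ, hτ⟩ := hmay
  -- Liveness gives only that some value is output (here stopping is the same event as outputting);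
  -- the value is then identified through the rule that allowed it.
  obtain ⟨τ', h⟩ := (e.output i hi).live τ _ hτ
  obtain ⟨o, ho⟩ := Option.ne_none_iff_exists'.1 (or_self_iff.1 h)
  obtain ⟨σ, -, hset, hσ⟩ := (e.output i hi).exists_lt (e.main.out_once i) ho
  rw [hones σ hset] at hσ
  rcases hσ with ⟨hlt, -⟩ | ⟨-, y, hy, rfl⟩
  · omega
  · have hyw : y = fun j : smallest (t + 1) S => EC.enc w j := by
      funext j
      obtain ⟨τ'', h''⟩ := hrbc j (Finset.filter_subset _ _ j.2)
      exact ((e.rbc j).out_once i).eq_of_eq_some (hy j) h''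
    rw [hyw, EC.dec_enc _ (card_smallest hcard)] at ho
    exact ⟨τ', ho⟩

end OciorABAStarExecution

end Ocior

theorem mainTheorem9 {n t : ℕ} (hn : 3 * t + 1 ≤ n) {A : Type*}
    (EC : Ocior.ErasureCode n (t + 1) A)
    (RBC : Fin n → Ocior.Protocol n A A)
    (hRBC : ∀ j, Ocior.IsReliableBroadcast t j (RBC j))
    (ABBA : Ocior.Protocol n Bool Bool)
    (hABBA : Ocior.IsByzantineAgreement t ABBA)
    (F : Finset (Fin n)) (hF : F.card ≤ t)
    (e : Ocior.OciorABAStarExecution EC RBC ABBA F)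
    (w : Fin (t + 1) → A) (hw : ∀ i ∉ F, e.main.Inputs i w) :
    (∀ i ∉ F, e.main.Outputs i (some w)) ∧
    ∃ S : Finset (Fin n), t + 1 ≤ S.card ∧
      (∀ i ∉ F, ∀ j ∈ S, (e.abba j).Outputs i true) ∧
      (∀ i ∉ F, ∀ j ∉ S, (e.abba j).Outputs i false) ∧
      (∀ i ∉ F, ∀ j ∈ S, (e.rbc j).Outputs i (EC.enc w j)) ∧
      (∀ i ∉ F, ∃ y : Ocior.smallest (t + 1) S → A,
        (∀ j : Ocior.smallest (t + 1) S, (e.rbc j).Outputs i (y j)) ∧ EC.dec (Ocior.smallest (t + 1) S) y = w) := by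
  classical
  obtain ⟨i₀, hi₀⟩ : ∃ i, i ∉ F := by
    by_contra! hall
    have := Finset.card_le_card (fun i _ => hall i : Finset.univ ⊆ F)
    rw [Finset.card_univ, Fintype.card_fin] at this
    omega
  -- Read off at one honest node; consistency of ABBA makes it common to all.
  let S : Finset (Fin n) := Finset.univ.filter fun j => (e.abba j).Outputs i₀ true
  have hS : ∀ j, j ∈ S ↔ (e.abba j).Outputs i₀ true := fun j => by simp [S]
  have hcard : t + 1 ≤ S.card := by
    obtain ⟨s, hs, htrue⟩ := Ocior.OciorABAStarExecution.exists_card_abba_outputs_true hn hRBC hABBA hF hw hi₀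
    exact hs.trans (Finset.card_le_card fun j hj => (hS j).2 (htrue j hj))
  have htrue : ∀ i ∉ F, ∀ j ∈ S, (e.abba j).Outputs i true := fun i hi j hj =>
    hABBA.consistency F hF _ (e.abba_mem j) i₀ hi₀ true ((hS j).1 hj) i hi
  have hfalse : ∀ i ∉ F, ∀ j ∉ S, (e.abba j).Outputs i false := by
    intro i hi j hj
    obtain ⟨b, hb⟩ := Ocior.OciorABAStarExecution.abba_outputs hRBC hABBA hF hw j i₀ hi₀
    cases b with
    | true => exact absurd ((hS j).2 hb) hj
    | false => exact hABBA.consistency F hF _ (e.abba_mem j) i₀ hi₀ false hb i hi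
  have hrbc : ∀ i ∉ F, ∀ j ∈ S, (e.rbc j).Outputs i (EC.enc w j) := fun i hi j hj =>
    Ocior.OciorABAStarExecution.rbc_outputs_of_abba_outputs_true hRBC hABBA hF hw hi₀ ((hS j).1 hj) i hi
  exact ⟨fun i hi => Ocior.OciorABAStarExecution.outputs_of_delivered hi hcard (htrue i hi) (hfalse i hi) (hrbc i hi),
    S, hcard, htrue, hfalse, hrbc, fun i hi => ⟨fun j => EC.enc w j,
      fun j => hrbc i hi j (Finset.filter_subset _ _ j.2),
      EC.dec_enc _ (Ocior.card_smallest hcard) w⟩⟩
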